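/- **Conventions.** A represented space is a set $X$ with a partial surjection $\delta_X:\subseteq\mathbb N^{\mathbb N}\to X$; the product $\mathbf X\times\mathbf Y$ is represented by $\langle p,q\rangle\mapsto(\delta_X(p),\delta_Y(q))$, and $\mathbb N^{\mathbb N}$ by the identity. For a multi-valued function $f:\subseteq\mathbf X\rightrightarrows\mathbf Y$ let $\operatorname{dom}(f)=\{x:f(x)\neq\emptyset\}$; composition is $z\in(f\circ g)(x)$ iff $g(x)\subseteq\operatorname{dom}(f)$ and $z\in f(y)$ for some $y\in g(x)$. A partial $F:\subseteq\mathbb N^{\mathbb N}\to\mathbb N^{\mathbb N}$ realizes $f$ ($F\vdash f$) if $\delta_YF(p)\in f(\delta_X(p))$ for all $p$ with $\delta_X(p)\in\operatorname{dom}(f)$. We write $f\le_W g$ if there are computable $K,H:\subseteq\mathbb N^{\mathbb N}\to\mathbb N^{\mathbb N}$ such that $K\langle\mathrm{id},GH\rangle\vdash f$ for all $G\vdash g$, and $\equiv_W$ for the induced equivalence. To the multi-valued functions on represented spaces we adjoin an element $\infty$ without realizers, so that $f\le_W\infty$ for all $f$; $\mathcal W$ is the partially ordered set of $\equiv_W$-classes,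 with least element $0$, the degree of the nowhere defined function. Let $\Phi_p(q)$ be the infinite output (if any) of a fixed universal machine on input $\langle p,q\rangle$, and let $\Phi_p^{\mathbf X,\mathbf Y}:=\delta_Y\circ\Phi_p\circ(\delta_X^{\mathrm{cyl}})^{-1}$, where $\delta_X^{\mathrm{cyl}}\langle q,r\rangle=\delta_X(q)$. Let $\mathcal M(\mathbf X,\mathbf Y)$ be the space of all multi-valued functions $\Phi_p^{\mathbf X,\mathbf Y}$, represented by $p\mapsto\Phi_p^{\mathbf X,\mathbf Y}$. For $f:\subseteq\mathbf U\rightrightarrows\mathbf V$ and $g:\subseteq\mathbf X\rightrightarrows\mathbf Y$ define: - $f\star g:\subseteq\mathcal M(\mathbf Y,\mathbb N^{\mathbb N}\times\mathbf U)\times\mathbf X\rightrightarrows\mathbb N^{\mathbb N}\times\mathbf V$ by $(f\star g)(T,x)=\big((\mathrm{id}\times f)\circ g^{\mathrm t}\big)(T,x)$, where $g^{\mathrm t}(T,x)=(T\circ g)(x)$; moreover $f\star\infty=\infty\star f=\infty\star\infty=\infty$. - if $\operatorname{dom}(g)\ne\emptyset$ or $\operatorname{dom}(f)=\emptyset$,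 then $(g\to f):\subseteq\mathbf U\rightrightarrows\mathcal M(\mathbf Y,\mathbf V)\times\mathbf X$ by $(H,x)\in(g\to f)(u)$ iff $x\in\operatorname{dom}(H\circ g)$ and $(H\circ g)(x)\subseteq f(u)$; if $\operatorname{dom}(g)=\emptyset\neq\operatorname{dom}(f)$, then $(g\to f)=\infty$; moreover $(\infty\to f)=(\infty\to\infty)=0$ and $(g\to\infty)=\infty$ for $g\ne\infty$. **Theorem.** Let $f,g,h$ range over the multi-valued functions on represented spaces together with $\infty$. 1. $(g\to f)\equiv_W\min_{\le_W}\{h: f\le_W g\star h\}$; that is, $f\le_W g\star(g\to f)$, and $f\le_W g\star h$ implies $(g\to f)\le_W h$. 2. $f\le_W g\star h\iff(g\to f)\le_W h$. 3. If $f\equiv_W f'$ and $g\equiv_W g'$, then $f\star g\equiv_W f'\star g'$ and $(f\to g)\equiv_W(f'\to g')$. Hence $\star$ and $\to$ induce operations on $\mathcal W$, and for all $\mathbf a,\mathbf b,\mathbf c\in\mathcal W$ the degree $(\mathbf b\to\mathbf a)$ is the least $\mathbf c$ with $\mathbf a\le_W\mathbf b\star\mathbf c$, and $\mathbf a\le_W\mathbf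 b\star\mathbf c\iff(\mathbf b\to\mathbf a)\le_W\mathbf c$. In particular $(\mathcal W,\ge_W,\star)$ is right residuated: for all $\mathbf b,\mathbf a\in\mathcal W$ there is a greatest $\mathbf c$ with respect to $\ge_W$ such that $\mathbf b\star\mathbf c\ge_W\mathbf a$. -/

import Mathlib

namespace Weihrauch

/-- Baire space `ℕ^ℕ`. -/
abbrev Baire : Type := ℕ → ℕ

/-- The standard pairing `⟨p, q⟩ = p 0, q 0, p 1, q 1, …` on Baire space. -/
def bpair (p q : Baire) : Baire :=
  fun n => if n % 2 = 0 then p (n / 2) else q (n / 2)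

/-! ### The universal machine

The universal machine reads an infinite input `o = ⟨p, q⟩`. The symbol `p 0 = o 0` is the index of
a program, that is, of a partial recursive function. To produce its `n`-th output symbol, the
machine runs this program on `n` and on longer and longer finite prefixes of the whole input `o`
(which contains all of `p` and of `q`). Whenever the program halts with `0`, one more input symbol
is read; as soon as it halts with `v + 1`, the symbol `v` is written. If the program fails to halt,
or asks for further symbols forever, then the `n`-th symbol is never written. -/

/-- Result of the program with index `o 0` on `n` and the prefix `o 0, …, o (k - 1)`. -/
def query (o : Baire) (n k : ℕ) : Part ℕ :=
  (Denumerable.ofNat Nat.Partrec.Code (o 0)).eval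
    (Encodable.encode (n, (List.range k).map o))

/-- The `n`-th symbol written by the universal machine on the infinite input `o`. -/
def utmOut (o : Baire) (n : ℕ) : Part ℕ :=
  (Nat.rfind fun k => (query o n k).map fun m => decide (m ≠ 0)).bind fun k =>
    (query o n k).map Nat.pred

/-- `Φ p : ⊆ ℕ^ℕ → ℕ^ℕ`: the value at `q` is the infinite sequence written by the universal machine
on input `⟨p, q⟩`; it is undefined if only finitely many initial symbols are written. -/
def Phi (p : Baire) : Baire →. Baire := fun q =>
  ⟨∀ n, (utmOut (bpair p q) n).Dom, fun h n => (utmOut (bpair p q) n).get (h n)⟩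

/-- A partial function on Baire space is computable if some `Φ p` with computable `p` agrees with
it on its domain. -/
def IsComputable (F : Baire →. Baire) : Prop :=
  ∃ p : Baire, Computable p ∧ ∀ q r, r ∈ F q → r ∈ Phi p q

/-! ### Represented spaces and multi-valued functions -/

/-- A represented space: a set with a partial surjection from Baire space onto it. -/
structure RepSpace where
  carrier : Type
  rep : Baire →. carrier
  rep_surj : ∀ x : carrier, ∃ p : Baire, x ∈ rep p

instance : CoeSort RepSpace Type := ⟨RepSpace.carrier⟩

/-- Baire space, represented by the identity. -/
def baireSpace : RepSpace where
  carrier := Baire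
  rep := fun p => Part.some p
  rep_surj := fun p => ⟨p, Part.mem_some p⟩

theorem bpair_even (p q : Baire) : (fun n => bpair p q (2 * n)) = p := by
  funext n; simp [bpair]

theorem bpair_odd (p q : Baire) : (fun n => bpair p q (2 * n + 1)) = q := by
  funext n
  have h : (2 * n + 1) / 2 = n := by omega
  simp [bpair, h]

/-- The product of represented spaces: `⟨p, q⟩` is a name of `(x, y)` if `p` is a name of `x`
and `q` is a name of `y`. -/
def RepSpace.prod (X Y : RepSpace) : RepSpace where
  carrier := X.carrier × Y.carrier
  rep := fun s =>
    (X.rep fun n => s (2 * n)).bind fun x => (Y.rep fun n => s (2 * n + 1)).map fun y => (x, y)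
  rep_surj := by
    rintro ⟨x, y⟩
    obtain ⟨p, hp⟩ := X.rep_surj x
    obtain ⟨q, hq⟩ := Y.rep_surj y
    refine ⟨bpair p q, ?_⟩
    rw [bpair_even, bpair_odd]
    exact Part.mem_bind hp (Part.mem_map _ hq)

/-- Multi-valued partial functions `f : ⊆ X ⇉ Y`; `x` belongs to the domain of `f` if and only if
`f x` is nonempty. -/
abbrev MV (X Y : RepSpace) : Type := X.carrier → Set Y.carrier

namespace MV

/-- The domain of a multi-valued function. -/
def dom {X Y : RepSpace} (f : MV X Y) : Set X.carrier := {x | (f x).Nonempty}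

/-- Composition `f ∘ g` of multi-valued functions: `x` is in its domain only if all of `g x` is
contained in the domain of `f`. -/
def comp {X Y Z : RepSpace} (f : MV Y Z) (g : MV X Y) : MV X Z :=
  fun x => {z | (∀ y ∈ g x, y ∈ f.dom) ∧ ∃ y ∈ g x, z ∈ f y}

/-- The identity of a represented space as a multi-valued function. -/
def ident (X : RepSpace) : MV X X := fun x => {x}

/-- The product `(f × g)(x, u) = f x × g u`. -/
def prod {X Y U V : RepSpace} (f : MV X Y) (g : MV U V) : MV (X.prod U) (Y.prod V) :=
  fun a => {b | b.1 ∈ f a.1 ∧ b.2 ∈ g a.2}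

end MV

/-- `Φ_p^{X,Y} = δ_Y ∘ Φ_p ∘ (δ_X^cyl)⁻¹`, where `δ_X^cyl ⟨q, r⟩ = δ_X q`. -/
def PhiMV (X Y : RepSpace) (p : Baire) : MV X Y := fun x =>
  {y | (∀ q r : Baire, x ∈ X.rep q → ∃ s ∈ Phi p (bpair q r), (Y.rep s).Dom) ∧
    ∃ q r : Baire, x ∈ X.rep q ∧ ∃ s ∈ Phi p (bpair q r), y ∈ Y.rep s}

/-- The represented space `M(X, Y)` of strongly continuous multi-valued functions; `p` is a name
of `Φ_p^{X,Y}`. -/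
def strongSpace (X Y : RepSpace) : RepSpace where
  carrier := {f : MV X Y // ∃ p : Baire, f = PhiMV X Y p}
  rep := fun p => Part.some ⟨PhiMV X Y p, p, rfl⟩
  rep_surj := by
    rintro ⟨f, p, rfl⟩
    exact ⟨p, Part.mem_some _⟩

namespace MV

/-- The transposition `g^t_U : ⊆ M(Y, U) × X ⇉ U`, `(h, x) ↦ (h ∘ g)(x)`. -/
def transpose {X Y : RepSpace} (g : MV X Y) (U : RepSpace) :
    MV ((strongSpace Y U).prod X) U :=
  fun a => MV.comp (X := X) (Y := Y) (Z := U) a.1.1 g a.2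

/-- The compositional product `f ⋆ g = (id × f) ∘ g^t_{ℕ^ℕ × U}`. -/
def star {U V X Y : RepSpace} (f : MV U V) (g : MV X Y) :
    MV ((strongSpace Y (baireSpace.prod U)).prod X) (baireSpace.prod V) :=
  MV.comp (MV.prod (MV.ident baireSpace) f) (g.transpose (baireSpace.prod U))

/-- The implication `(g → f) : ⊆ U ⇉ M(Y, V) × X` at `u`: all pairs `(H, x)` such that `H ∘ g` is
defined at `x` and `(H ∘ g)(x) ⊆ f u`. If the domain of `g` is nonempty, then its domain is the
domain of `f`. -/
def imp {U V X Y : RepSpace} (g : MV X Y) (f : MV U V) :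
    MV U ((strongSpace Y V).prod X) :=
  fun u => {a | a.2 ∈ (MV.comp (X := X) (Y := Y) (Z := V) a.1.1 g).dom ∧
    MV.comp (X := X) (Y := Y) (Z := V) a.1.1 g a.2 ⊆ f u}

end MV

/-! ### Weihrauch reducibility -/

/-- Multi-valued functions on represented spaces, together with the additional top element `∞`. -/
inductive Problem : Type 1
  | fn {X Y : RepSpace} (f : MV X Y) : Problem
  | infty : Problem

namespace Problem

/-- `F` is a realizer of the given problem. The element `∞` has no realizers. -/
def IsRealizer (F : Baire →. Baire) : Problem → Prop
  | @fn X Y f => ∀ (p : Baire) (x : X), x ∈ X.rep p → x ∈ f.dom →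
      ∃ q ∈ F p, ∃ y ∈ Y.rep q, y ∈ f x
  | infty => False

/-- The partial function `K ⟨id, G H⟩`. -/
def wrap (K H G : Baire →. Baire) : Baire →. Baire := fun p =>
  (H p).bind fun a => (G a).bind fun b => K (bpair p b)

/-- Weihrauch reducibility `f ≤_W g`. -/
def WLE (f g : Problem) : Prop :=
  ∃ K H : Baire →. Baire, IsComputable K ∧ IsComputable H ∧
    ∀ G : Baire →. Baire, IsRealizer G g → IsRealizer (wrap K H G) f

/-- Weihrauch equivalence `f ≡_W g`. -/
def WEquiv (f g : Problem) : Prop := WLE f g ∧ WLE g f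

/-- The nowhere defined multi-valued function, representing the least degree `0`. -/
def zero : Problem := fn (X := baireSpace) (Y := baireSpace) fun _ => ∅

/-- The compositional product, with `f ⋆ ∞ = ∞ ⋆ f = ∞`. -/
def star : Problem → Problem → Problem
  | fn f, fn g => fn (f.star g)
  | _, _ => infty

open Classical in
/-- The implication `imp g f = (g → f)`, with `(∞ → f) = 0`, with `(g → ∞) = ∞` for `g ≠ ∞`, and
with `(g → f) = ∞` if `g` is nowhere defined and `f` is not. -/
noncomputable def imp : Problem → Problem → Problem
  | infty, _ => zero
  | fn _, infty => infty
  | fn g, fn f => if g.dom.Nonempty ∨ f.dom = ∅ then fn (g.imp f) else infty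

end Problem

/-- The Weihrauch degrees: classes of problems modulo `≡_W`. -/
def Degree : Type 1 := Quot Problem.WEquiv

/-- The Weihrauch degree of a problem. -/
def Degree.of (f : Problem) : Degree := Quot.mk _ f

/-- The order induced by `≤_W` on degrees. -/
instance : LE Degree :=
  ⟨fun a b => ∃ f g : Problem, Degree.of f = a ∧ Degree.of g = b ∧ Problem.WLE f g⟩

/-- Right residuation of a binary operation with respect to an order relation `le`: for all `x`
and `z` there is a `le`-greatest `y` with `le (op x y) z`. -/
def RightResiduated {L : Type*} (le : L → L → Prop) (op : L → L → L) : Prop :=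
  ∀ x z : L, ∃ y : L, le (op x y) z ∧ ∀ y' : L, le (op x y') z → le y' y

end Weihrauch

/-! The theorem is a Galois connection between `g ⋆ ·` and `g → ·`, and its content lies in three
reductions.

Unit (`wle_star_imp`): an answer of `(g → f)` is a function `H` together with an input `x` of `g`. A
name of `H` is a program, hence a point of Baire space, so the factor `ℕ^ℕ` in `⋆` can carry it past
the call of `g`; afterwards it is run on the answer of `g`.

Minimality (`imp_wle_of_wle_star`): in a reduction of `f` to `g ⋆ h`, an answer of `h` determines an
input of `g` and a point `s` of Baire space. The outer functional `K`, with the original input and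
`s` frozen by the parameter theorem, is a program taking answers of `g` to answers of `f`. This
program and the input of `g` solve `(g → f)`.

Monotonicity (`star_mono`): both reductions are absorbed into the middle program, whose `ℕ^ℕ` output
also transports the data needed for translating back.

The equivalence, the monotonicity of `→`, and the statements about degrees then follow formally. Two
tools support the constructions: `isComputable_iff` replaces programs of the universal machine by
monotone primitive recursive approximations, which are easy to compose, and `wle_fn_iff` removes the
quantifier over realizers from reducibility. -/

namespace Weihrauch

open Nat.Partrec (Code)

/-! ### Approximations of functionals on Baire space -/

/-- The prefix of length `k` of an infinite sequence. -/
def pre (o : Baire) (k : ℕ) : List ℕ := (List.range k).map o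

@[simp] theorem length_pre (o : Baire) (k : ℕ) : (pre o k).length = k := by simp [pre]

theorem pre_isPrefix (o : Baire) {k l : ℕ} (h : k ≤ l) : pre o k <+: pre o l := by
  obtain ⟨d, rfl⟩ := Nat.exists_eq_add_of_le h
  refine ⟨(List.range d).map fun i => o (k + i), ?_⟩
  simp [pre, List.range_add, Function.comp_def]

theorem take_pre (o : Baire) {k l : ℕ} (h : k ≤ l) : (pre o l).take k = pre o k := by
  have := List.prefix_iff_eq_take.1 (pre_isPrefix o h)
  rw [length_pre] at this
  exact this.symm

theorem getElem?_pre (o : Baire) {i k : ℕ} (h : i < k) : (pre o k)[i]? = some (o i) := by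
  simp [pre, h]

/-- A primitive recursive approximation of a functional: `φ n σ` is the `n`-th output symbol if it
is determined by the finite input `σ`, and longer inputs determine the same symbol. -/
structure IsApprox (φ : ℕ → List ℕ → Option ℕ) : Prop where
  primrec : Primrec₂ φ
  mono : ∀ {n σ τ v}, σ <+: τ → φ n σ = some v → φ n τ = some v

/-- The approximation `φ` produces the infinite output `r` on the infinite input `o`. -/
def Produces (φ : ℕ → List ℕ → Option ℕ) (o r : Baire) : Prop :=
  ∀ n, ∃ k, φ n (pre o k) = some (r n)

/-- The functional `F` is extended by a functional with a primitive recursive approximation. -/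
def HasApprox (F : Baire →. Baire) : Prop :=
  ∃ φ, IsApprox φ ∧ ∀ o r, r ∈ F o → Produces φ o r

theorem HasApprox.mono {F G : Baire →. Baire} (hG : HasApprox G)
    (h : ∀ o r, r ∈ F o → r ∈ G o) : HasApprox F := by
  obtain ⟨φ, hφ, H⟩ := hG
  exact ⟨φ, hφ, fun o r hr => H o r (h o r hr)⟩

/-- The longest output prefix, of length at most that of the input `σ`, determined by `σ`. -/
def collect (ψ : ℕ → List ℕ → Option ℕ) (σ : List ℕ) : List ℕ :=
  (List.range σ.length).foldr (fun i acc => (ψ i σ).casesOn [] fun v => v :: acc) []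

theorem primrec_collect {ψ : ℕ → List ℕ → Option ℕ} (hψ : Primrec₂ ψ) : Primrec (collect ψ) := by
  refine Primrec.list_foldr (h := fun σ a => ((ψ a.1 σ).casesOn [] fun v => v :: a.2 : List ℕ))
    (Primrec.list_range.comp Primrec.list_length) (Primrec.const []) ?_
  refine Primrec.option_casesOn (hψ.comp (Primrec.fst.comp Primrec.snd) Primrec.fst)
    (Primrec.const []) ?_
  exact Primrec.list_cons.comp Primrec.snd (Primrec.snd.comp (Primrec.snd.comp Primrec.fst))

/-- The fold stops at the first undetermined symbol. The free `base` stands for the symbols gained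
when the longer input also allows more indices to be tried. -/
theorem foldr_collect_isPrefix {s t : ℕ → Option ℕ} (h : ∀ i v, s i = some v → t i = some v)
    (l : List ℕ) (base : List ℕ) :
    l.foldr (fun i acc => ((s i).casesOn [] fun v => v :: acc : List ℕ)) [] <+:
      l.foldr (fun i acc => ((t i).casesOn [] fun v => v :: acc : List ℕ)) base := by
  induction l with
  | nil => simp
  | cons a l ih =>
    simp only [List.foldr_cons]
    cases hs : s a with
    | none => simp
    | some v =>
      rw [h _ _ hs]
      simpa using ih

theorem collect_isPrefix {ψ : ℕ → List ℕ → Option ℕ} (hψ : IsApprox ψ) {σ τ : List ℕ}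
    (h : σ <+: τ) : collect ψ σ <+: collect ψ τ := by
  obtain ⟨d, hd⟩ := Nat.exists_eq_add_of_le h.length_le
  unfold collect
  rw [hd, List.range_add, List.foldr_append]
  exact foldr_collect_isPrefix (fun i v hv => hψ.mono h hv) _ _

theorem foldr_collect_append {s : ℕ → Option ℕ} {r : Baire} (l : List ℕ)
    (h : ∀ i ∈ l, s i = some (r i)) (base : List ℕ) :
    l.foldr (fun i acc => ((s i).casesOn [] fun v => v :: acc : List ℕ)) base =
      l.map r ++ base := by
  induction l with
  | nil => simp
  | cons a l ih =>
    simp only [List.foldr_cons, List.map_cons, List.cons_append]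
    rw [h a (by simp), ih fun i hi => h i (by simp [hi])]

theorem exists_bound_of_mono {P : ℕ → ℕ → Prop} (hP : ∀ i k l, k ≤ l → P i k → P i l)
    (h : ∀ i, ∃ k, P i k) (m : ℕ) : ∃ k, ∀ i < m, P i k := by
  choose f hf using h
  refine ⟨(Finset.range m).sup f, fun i hi => hP _ _ _ ?_ (hf i)⟩
  exact Finset.le_sup (Finset.mem_range.2 hi)

theorem exists_pre_isPrefix_collect {ψ : ℕ → List ℕ → Option ℕ} (hψ : IsApprox ψ) {o r : Baire}
    (h : Produces ψ o r) (m : ℕ) : ∃ k, pre r m <+: collect ψ (pre o k) := by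
  obtain ⟨k, hk⟩ := exists_bound_of_mono (P := fun i k => ψ i (pre o k) = some (r i))
    (fun i k l hkl H => hψ.mono (pre_isPrefix o hkl) H) h m
  -- `collect` only tries indices below the input length, so a prefix long enough to determine the
  -- symbols must also have length at least `m`.
  refine ⟨m + k, ?_⟩
  unfold collect
  rw [length_pre, List.range_add, List.foldr_append, foldr_collect_append (r := r)]
  · exact List.prefix_append _ _
  · intro i hi
    exact hψ.mono (pre_isPrefix o (Nat.le_add_left _ _)) (hk i (List.mem_range.1 hi))

/-- Continuity makes this work: each symbol of the outer output depends on a finite prefix of the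
intermediate sequence, which a finite prefix of the input already determines. -/
theorem HasApprox.comp {F G : Baire →. Baire} (hG : HasApprox G) (hF : HasApprox F) :
    HasApprox fun p => (F p).bind G := by
  obtain ⟨φ, hφ, HG⟩ := hG
  obtain ⟨ψ, hψ, HF⟩ := hF
  refine ⟨fun n σ => φ n (collect ψ σ), ⟨?_, fun h => hφ.mono (collect_isPrefix hψ h)⟩, ?_⟩
  · exact hφ.primrec.comp Primrec.fst ((primrec_collect hψ.primrec).comp Primrec.snd)
  · intro o r hr n
    obtain ⟨a, ha, hr⟩ := Part.mem_bind_iff.1 hr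
    obtain ⟨m, hm⟩ := HG a r hr n
    obtain ⟨k, hk⟩ := exists_pre_isPrefix_collect hψ (HF o a ha) m
    exact ⟨k, hφ.mono hk hm⟩

theorem HasApprox.pair {F G : Baire →. Baire} (hF : HasApprox F) (hG : HasApprox G) :
    HasApprox fun p => (F p).bind fun a => (G p).map (bpair a) := by
  obtain ⟨φ, hφ, HF⟩ := hF
  obtain ⟨ψ, hψ, HG⟩ := hG
  refine ⟨fun n σ => if n % 2 = 0 then φ (n / 2) σ else ψ (n / 2) σ, ⟨?_, ?_⟩, ?_⟩
  · have half : Primrec fun a : ℕ × List ℕ => a.1 / 2 :=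
      Primrec.nat_div.comp Primrec.fst (Primrec.const 2)
    exact Primrec.ite
      (Primrec.eq.comp (Primrec.nat_mod.comp Primrec.fst (Primrec.const 2)) (Primrec.const 0))
      (hφ.primrec.comp half Primrec.snd) (hψ.primrec.comp half Primrec.snd)
  · intro n σ τ v h
    split_ifs
    exacts [hφ.mono h, hψ.mono h]
  · intro o r hr n
    obtain ⟨a, ha, hr⟩ := Part.mem_bind_iff.1 hr
    obtain ⟨b, hb, rfl⟩ := (Part.mem_map_iff _).1 hr
    dsimp only [bpair]
    split_ifs
    exacts [HF o a ha _, HG o b hb _]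

theorem HasApprox.reindex {e : ℕ → ℕ} (he : Primrec e) :
    HasApprox fun p => Part.some fun n => p (e n) := by
  refine ⟨fun n σ => σ[e n]?, ⟨Primrec.list_getElem?.comp Primrec.snd (he.comp Primrec.fst), ?_⟩, ?_⟩
  · rintro n σ _ v ⟨τ, rfl⟩ h
    obtain ⟨hn, -⟩ := List.getElem?_eq_some_iff.1 h
    rw [List.getElem?_append_left hn, h]
  · intro o r hr n
    rw [Part.mem_some_iff] at hr
    subst hr
    exact ⟨e n + 1, getElem?_pre o (Nat.lt_succ_self _)⟩

theorem HasApprox.const {c : Baire} (hc : Computable c) : HasApprox fun _ => Part.some c := by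
  obtain ⟨cd, hcd⟩ := Code.exists_code.1 (Partrec.nat_iff.1 hc)
  -- The input serves only as a clock: its length bounds the running time.
  refine ⟨fun n σ => Code.evaln σ.length cd n, ⟨?_, ?_⟩, ?_⟩
  · exact Code.primrec_evaln.comp (((Primrec.list_length.comp Primrec.snd).pair
      (Primrec.const cd)).pair Primrec.fst)
  · intro n σ τ v h
    exact Code.evaln_mono h.length_le
  · intro o r hr n
    rw [Part.mem_some_iff] at hr
    subst hr
    have : r n ∈ cd.eval n := by rw [hcd]; exact Part.mem_some _
    obtain ⟨k, hk⟩ := Code.evaln_complete.1 this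
    exact ⟨k, by simpa using hk⟩

/-! ### The universal functional -/

/-- Time-bounded run of the program with index `σ 0` on `n` and the prefix of `σ` of length `j`. -/
def queryn (σ : List ℕ) (n j : ℕ) : Option ℕ :=
  σ[0]?.bind fun c => Code.evaln σ.length (Denumerable.ofNat Code c)
    (Encodable.encode (n, σ.take j))

theorem primrec_queryn : Primrec fun a : (ℕ × List ℕ) × ℕ => queryn a.1.2 a.1.1 a.2 := by
  have hs : Primrec fun a : (ℕ × List ℕ) × ℕ => a.1.2 := Primrec.snd.comp Primrec.fst
  refine Primrec.option_bind (Primrec.list_getElem?.comp hs (Primrec.const 0)) ?_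
  have hs' : Primrec fun a : ((ℕ × List ℕ) × ℕ) × ℕ => a.1.1.2 := hs.comp Primrec.fst
  exact Code.primrec_evaln.comp (((Primrec.list_length.comp hs').pair
    ((Primrec.ofNat Code).comp Primrec.snd)).pair
    (Primrec.encode.comp ((Primrec.fst.comp (Primrec.fst.comp Primrec.fst)).pair
      (Primrec.list_take.comp (Primrec.snd.comp Primrec.fst) hs'))))

/-- The bound on `j` matters: otherwise `σ.take j` and `τ.take j` may differ, so that the program is
run on different inputs. -/
theorem queryn_mono {σ τ : List ℕ} (h : σ <+: τ) {n j v : ℕ} (hj : j ≤ σ.length)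
    (hv : queryn σ n j = some v) : queryn τ n j = some v := by
  obtain ⟨c, hc, hv⟩ := Option.bind_eq_some_iff.1 hv
  have hl := h.length_le
  obtain ⟨τ, rfl⟩ := h
  obtain ⟨h0, -⟩ := List.getElem?_eq_some_iff.1 hc
  refine Option.bind_eq_some_iff.2 ⟨c, by rw [List.getElem?_append_left h0, hc], ?_⟩
  rw [List.take_append_of_le_length hj]
  exact Code.evaln_mono hl hv

theorem exists_queryn {o : Baire} {n j v : ℕ} (h : v ∈ query o n j) :
    ∃ k, j ≤ k ∧ queryn (pre o k) n j = some v := by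
  obtain ⟨k, hk⟩ := Code.evaln_complete.1 h
  refine ⟨max (k + 1) j, le_max_right _ _, Option.bind_eq_some_iff.2 ⟨o 0, ?_, ?_⟩⟩
  · exact getElem?_pre o (by omega)
  · rw [length_pre, take_pre o (le_max_right _ _)]
    exact Code.evaln_mono (by omega) hk

/-- The first nonzero answer minus one, if all the earlier queries have been answered. -/
def firstAnswer (s : ℕ → Option ℕ) (l : List ℕ) (base : Option ℕ) : Option ℕ :=
  l.foldr (fun j acc => (s j).casesOn none fun v => v.casesOn acc some) base

/-- An answer found within `l` is independent of whatever follows, so further queries may be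
appended through `base`. -/
theorem firstAnswer_mono {s t : ℕ → Option ℕ} {l : List ℕ}
    (h : ∀ i ∈ l, ∀ v, s i = some v → t i = some v) {base : Option ℕ} {v : ℕ}
    (hv : firstAnswer s l none = some v) : firstAnswer t l base = some v := by
  induction l with
  | nil => simp [firstAnswer] at hv
  | cons a l ih =>
    unfold firstAnswer at hv ih ⊢
    simp only [List.foldr_cons] at hv ⊢
    cases hs : s a with
    | none => simp [hs] at hv
    | some w =>
      rw [h a (by simp) w hs]
      rw [hs] at hv
      cases w with
      | zero => exact ih (fun i hi => h i (by simp [hi])) hv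
      | succ w => exact hv

theorem firstAnswer_range {s : ℕ → Option ℕ} {k v : ℕ} (h0 : ∀ j < k, s j = some 0)
    (hk : s k = some (v + 1)) (base : Option ℕ) :
    firstAnswer s (List.range (k + 1)) base = some v := by
  have key : ∀ (l : List ℕ) (base : Option ℕ), (∀ j ∈ l, s j = some 0) →
      firstAnswer s l base = base := by
    intro l base hl
    induction l with
    | nil => rfl
    | cons a l ih =>
      unfold firstAnswer at ih ⊢
      rw [List.foldr_cons, hl a (by simp)]
      exact ih fun i hi => hl i (by simp [hi])
  rw [List.range_succ]
  unfold firstAnswer at key ⊢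
  rw [List.foldr_append, List.foldr_cons, hk]
  exact key _ _ fun j hj => h0 j (List.mem_range.1 hj)

/-- Approximation of the universal machine. -/
def utmApprox (n : ℕ) (σ : List ℕ) : Option ℕ :=
  firstAnswer (queryn σ n) (List.range (σ.length + 1)) none

theorem isApprox_utmApprox : IsApprox utmApprox := by
  constructor
  · refine Primrec.list_foldr (f := fun a : ℕ × List ℕ => List.range (a.2.length + 1))
      (h := fun a b => ((queryn a.2 a.1 b.1).casesOn none fun v => v.casesOn b.2 some : Option ℕ))
      (Primrec.list_range.comp (Primrec.succ.comp (Primrec.list_length.comp Primrec.snd)))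
      (Primrec.const none) ?_
    refine Primrec.option_casesOn
      (primrec_queryn.comp (Primrec.fst.pair (Primrec.fst.comp Primrec.snd)))
      (Primrec.const none) ?_
    exact Primrec.nat_casesOn Primrec.snd (Primrec.snd.comp (Primrec.snd.comp Primrec.fst))
      (Primrec.option_some.comp Primrec.snd)
  · intro n σ τ v h hv
    obtain ⟨d, hd⟩ := Nat.exists_eq_add_of_le h.length_le
    unfold utmApprox
    rw [hd, Nat.add_right_comm, List.range_add]
    unfold firstAnswer
    rw [List.foldr_append]
    exact firstAnswer_mono
      (fun i hi v => queryn_mono h (Nat.lt_succ_iff.1 (List.mem_range.1 hi))) hv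

theorem exists_utmApprox {o : Baire} {n v : ℕ} (h : v ∈ utmOut o n) :
    ∃ k, utmApprox n (pre o k) = some v := by
  obtain ⟨k, hk, hv⟩ := Part.mem_bind_iff.1 h
  obtain ⟨w, hw, rfl⟩ := (Part.mem_map_iff _).1 hv
  obtain ⟨hk, hlt⟩ := Nat.mem_rfind.1 hk
  obtain ⟨w', hw', h1⟩ := (Part.mem_map_iff _).1 hk
  obtain rfl := Part.mem_unique hw hw'
  have hw0 : w = w.pred + 1 := (Nat.succ_pred (by simpa using h1)).symm
  have hz : ∀ j < k, 0 ∈ query o n j := by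
    intro j hj
    obtain ⟨u, hu, h1⟩ := (Part.mem_map_iff _).1 (hlt hj)
    have : u = 0 := by simpa using h1
    exact this ▸ hu
  -- The clause `j ≤ b` is included so that `queryn_mono` applies and the predicate is monotone in
  -- `b`.
  obtain ⟨b, hb⟩ := exists_bound_of_mono
    (P := fun j b => j ≤ b ∧ (j < k → queryn (pre o b) n j = some 0))
    (fun j b b' hbb H => ⟨H.1.trans hbb, fun hj =>
      queryn_mono (pre_isPrefix o hbb) (by simpa using H.1) (H.2 hj)⟩)
    (fun j => by
      by_cases hj : j < k
      · obtain ⟨b, hb, hq⟩ := exists_queryn (hz j hj)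
        exact ⟨b, hb, fun _ => hq⟩
      · exact ⟨j, le_rfl, fun h => absurd h hj⟩) k
  obtain ⟨b', hb', hq⟩ := exists_queryn hw
  have hkb : k ≤ max b b' := hb'.trans (le_max_right _ _)
  refine ⟨max b b', ?_⟩
  obtain ⟨d, hd⟩ := Nat.exists_eq_add_of_le hkb
  unfold utmApprox
  rw [length_pre]
  conv_lhs => arg 2; rw [hd, Nat.add_right_comm, List.range_add]
  unfold firstAnswer
  rw [List.foldr_append]
  refine firstAnswer_range (s := queryn (pre o (max b b')) n) ?_ ?_ _
  · intro j hj
    exact queryn_mono (pre_isPrefix o (le_max_left _ _)) (by simpa using (hb j hj).1)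
      ((hb j hj).2 hj)
  · rw [← hw0]
    exact queryn_mono (pre_isPrefix o (le_max_right _ _)) (by simpa using hb') hq

/-- The functional computed by the universal machine. -/
def universal : Baire →. Baire := fun o =>
  ⟨∀ n, (utmOut o n).Dom, fun h n => (utmOut o n).get (h n)⟩

theorem mem_universal {o r : Baire} : r ∈ universal o ↔ ∀ n, r n ∈ utmOut o n := by
  constructor
  · rintro ⟨h, rfl⟩ n
    exact Part.get_mem (h n)
  · intro h
    exact ⟨fun n => (h n).1, funext fun n => (h n).2⟩

theorem HasApprox.universal : HasApprox universal :=
  ⟨utmApprox, isApprox_utmApprox, fun _ _ hr n => exists_utmApprox (mem_universal.1 hr n)⟩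

/-- A functional with an approximation has a program for the universal machine. -/
theorem HasApprox.exists_program {F : Baire →. Baire} (hF : HasApprox F) :
    ∃ c : ℕ, ∀ o r, o 0 = c → r ∈ F o → r ∈ Weihrauch.universal o := by
  obtain ⟨φ, hφ, H⟩ := hF
  -- This is the protocol of the machine: `0` requests another input symbol, `v + 1` writes `v`.
  let ψ : ℕ × List ℕ → ℕ := fun a => (φ a.1 a.2).casesOn 0 Nat.succ
  have hψ : Primrec ψ := Primrec.option_casesOn hφ.primrec (Primrec.const 0)
    (Primrec.succ.comp Primrec.snd)
  have hψ' : Nat.Partrec fun n => ((Encodable.decode (α := ℕ × List ℕ) n).map ψ : Option ℕ) := by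
    refine Partrec.nat_iff.1 (Computable.ofOption ?_)
    exact (Primrec.option_map Primrec.decode (hψ.comp Primrec.snd).to₂).to_comp
  obtain ⟨cd, hcd⟩ := Code.exists_code.1 hψ'
  refine ⟨Encodable.encode cd, fun o r ho hr => mem_universal.2 fun n => ?_⟩
  have hq : ∀ k, query o n k = Part.some (ψ (n, pre o k)) := by
    intro k
    unfold query
    rw [ho, Denumerable.ofNat_encode, hcd]
    simp [pre]
  have hex := H o r hr n
  classical
  -- The machine stops at the first nonzero reply. By monotonicity any earlier value of `φ` would
  -- already equal `r n`, so minimality of `k` forces all earlier replies to be `0`.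
  let k := Nat.find hex
  have hk : φ n (pre o k) = some (r n) := Nat.find_spec hex
  have hmin : ∀ j < k, φ n (pre o j) = none := by
    intro j hj
    cases hj' : φ n (pre o j) with
    | none => rfl
    | some v =>
      have := hφ.mono (pre_isPrefix o hj.le) hj'
      rw [hk, Option.some_inj] at this
      exact absurd (this ▸ hj') (Nat.find_min hex hj)
  refine Part.mem_bind (a := k) (Nat.mem_rfind.2 ⟨?_, fun {j} hj => ?_⟩) ?_
  · rw [hq]; simp [ψ, hk]
  · rw [hq]; simp [ψ, hmin j hj]
  · rw [hq]; simp [ψ, hk]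

/-! ### Computable functionals -/

/-- The first component of a pair. -/
def left (p : Baire) : Baire := fun n => p (2 * n)

/-- The second component of a pair. -/
def right (p : Baire) : Baire := fun n => p (2 * n + 1)

@[simp] theorem left_bpair (p q : Baire) : left (bpair p q) = p := bpair_even p q

@[simp] theorem right_bpair (p q : Baire) : right (bpair p q) = q := bpair_odd p q

theorem HasApprox.left : HasApprox fun p => Part.some (left p) :=
  HasApprox.reindex Primrec.nat_double

theorem HasApprox.right : HasApprox fun p => Part.some (right p) :=
  HasApprox.reindex Primrec.nat_double_succ

theorem HasApprox.ident : HasApprox fun p => Part.some p :=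
  HasApprox.reindex Primrec.id

/-- The parameter theorem for functionals with an approximation; the parameter transformation
preserves computability. -/
theorem HasApprox.exists_smn {F : Baire →. Baire} (hF : HasApprox F) :
    ∃ S : Baire → Baire, HasApprox (fun p => Part.some (S p)) ∧
      (∀ p, Computable p → Computable (S p)) ∧
      ∀ p q r, r ∈ F (bpair p q) → r ∈ Phi (S p) q := by
  -- The new program is `p` with the index `c` put in front. In the pairing of `c, p 0, p 1, …` with
  -- `q` this shifts the even positions by two, and the reindexing recovers `⟨p, q⟩`.
  have he : Primrec fun n => if n % 2 = 0 then n + 2 else n :=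
    Primrec.ite (Primrec.eq.comp (Primrec.nat_mod.comp Primrec.id (Primrec.const 2))
      (Primrec.const 0)) (Primrec.succ.comp Primrec.succ) Primrec.id
  obtain ⟨c, hc⟩ := (hF.comp (HasApprox.reindex he)).exists_program
  refine ⟨fun p n => n.casesOn c p, ⟨fun n σ => n.casesOn (some c) fun m => σ[m]?, ⟨?_, ?_⟩, ?_⟩,
    ?_, ?_⟩
  · exact Primrec.nat_casesOn Primrec.fst (Primrec.const _)
      (Primrec.list_getElem?.comp (Primrec.snd.comp Primrec.fst) Primrec.snd)
  · rintro (_ | n) σ _ v ⟨τ, rfl⟩ h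
    · exact h
    · dsimp only at h ⊢
      obtain ⟨hn, -⟩ := List.getElem?_eq_some_iff.1 h
      rw [List.getElem?_append_left hn, h]
  · intro o r hr n
    rw [Part.mem_some_iff] at hr
    subst hr
    cases n with
    | zero => exact ⟨0, rfl⟩
    | succ n => exact ⟨n + 1, getElem?_pre o (Nat.lt_succ_self _)⟩
  · intro p hp
    exact Computable.nat_casesOn Computable.id (Computable.const c) (hp.comp Computable.snd)
  · intro p q r hr
    refine hc _ r rfl (Part.mem_bind (Part.mem_some _) ?_)
    convert hr using 2
    funext n
    unfold bpair
    rcases Nat.mod_two_eq_zero_or_one n with h | h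
    · simp [h]
    · simp [h]

/-- The universal functional itself has an approximation, and fixing a computable program preserves
this; conversely, the parameter theorem with a dummy parameter provides a computable program. -/
theorem isComputable_iff {F : Baire →. Baire} : IsComputable F ↔ HasApprox F := by
  constructor
  · rintro ⟨p, hp, H⟩
    refine (HasApprox.universal.comp ((HasApprox.const hp).pair HasApprox.ident)).mono
      fun o r hr => ?_
    exact Part.mem_bind (Part.mem_bind (Part.mem_some p) (Part.mem_map _ (Part.mem_some o)))
      (H o r hr)
  · intro hF
    obtain ⟨S, -, hS, H⟩ := (hF.comp HasApprox.right).exists_smn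
    refine ⟨S fun _ => 0, hS _ (Computable.const 0), fun q r hr => H _ _ _ ?_⟩
    refine Part.mem_bind (Part.mem_some _) ?_
    rwa [right_bpair]

namespace HasApprox

theorem comp_total {F : Baire →. Baire} {A : Baire → Baire} (hF : HasApprox F)
    (hA : HasApprox fun p => Part.some (A p)) : HasApprox fun p => F (A p) :=
  (hF.comp hA).mono fun _ _ hr => Part.mem_bind (Part.mem_some _) hr

theorem pair_total {A B : Baire → Baire} (hA : HasApprox fun p => Part.some (A p))
    (hB : HasApprox fun p => Part.some (B p)) :
    HasApprox fun p => Part.some (bpair (A p) (B p)) :=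
  (hA.pair hB).mono fun p r hr => by
    obtain rfl := Part.mem_some_iff.1 hr
    exact Part.mem_bind (Part.mem_some _) (Part.mem_map _ (Part.mem_some _))

/-- Sequential composition in which the second stage still sees the original input; the multi-stage
functionals below are assembled from it. -/
theorem bind {F : Baire →. Baire} {G : Baire → Baire →. Baire} (hF : HasApprox F)
    (hG : HasApprox fun o => G (Weihrauch.left o) (Weihrauch.right o)) :
    HasApprox fun o => (F o).bind (G o) :=
  (hG.comp (HasApprox.ident.pair hF)).mono fun o r hr => by
    obtain ⟨a, ha, hr⟩ := Part.mem_bind_iff.1 hr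
    refine Part.mem_bind (Part.mem_bind (Part.mem_some o) (Part.mem_map _ ha)) ?_
    rwa [left_bpair, right_bpair]

theorem Phi {A B : Baire → Baire} (hA : HasApprox fun p => Part.some (A p))
    (hB : HasApprox fun p => Part.some (B p)) : HasApprox fun p => Weihrauch.Phi (A p) (B p) :=
  HasApprox.universal.comp_total (hA.pair_total hB)

theorem zero : HasApprox fun _ => Part.some fun _ => 0 := HasApprox.const (Computable.const 0)

end HasApprox

/-! ### Names and domains -/

theorem mem_prod_rep {X Y : RepSpace} {s : Baire} {a : X.carrier × Y.carrier} :
    a ∈ (X.prod Y).rep s ↔ a.1 ∈ X.rep (left s) ∧ a.2 ∈ Y.rep (right s) := by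
  obtain ⟨x, y⟩ := a
  constructor
  · intro h
    obtain ⟨x', hx, h⟩ := Part.mem_bind_iff.1 h
    obtain ⟨y', hy, h⟩ := (Part.mem_map_iff _).1 h
    obtain ⟨rfl, rfl⟩ := Prod.mk.inj h
    exact ⟨hx, hy⟩
  · rintro ⟨hx, hy⟩
    exact Part.mem_bind hx (Part.mem_map _ hy)

theorem mem_prod_rep_bpair {X Y : RepSpace} {p q : Baire} {a : X.carrier × Y.carrier} :
    a ∈ (X.prod Y).rep (bpair p q) ↔ a.1 ∈ X.rep p ∧ a.2 ∈ Y.rep q := by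
  rw [mem_prod_rep, left_bpair, right_bpair]

theorem mem_baireSpace_rep {p q : Baire} : p ∈ baireSpace.rep q ↔ p = q := Part.mem_some_iff

theorem mem_strongSpace_rep {X Y : RepSpace} {p : Baire} {T : (strongSpace X Y).carrier} :
    T ∈ (strongSpace X Y).rep p ↔ T.1 = PhiMV X Y p :=
  Part.mem_some_iff.trans Subtype.ext_iff

/-- Every name of a point in the domain is mapped to a name of a value. -/
theorem exists_mem_PhiMV {X Y : RepSpace} {p q : Baire} {x : X.carrier}
    (hx : x ∈ (PhiMV X Y p).dom) (hq : x ∈ X.rep q) (r : Baire) :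
    ∃ s ∈ Phi p (bpair q r), ∃ y ∈ Y.rep s, y ∈ PhiMV X Y p x := by
  obtain ⟨_, h, -⟩ := hx
  obtain ⟨s, hs, hd⟩ := h q r hq
  exact ⟨s, hs, _, Part.get_mem hd, h, q, r, hq, s, hs, Part.get_mem hd⟩

/-- If every name of `x` is mapped to a name of an element of `B`, then `x` is in the domain of
`Φ_p^{X,Y}`, and all the values at `x` are in `B`. -/
theorem PhiMV_subset {X Y : RepSpace} {p : Baire} {x : X.carrier} {B : Set Y.carrier}
    (h : ∀ q r, x ∈ X.rep q → ∃ s ∈ Phi p (bpair q r), ∃ y ∈ Y.rep s, y ∈ B) :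
    x ∈ (PhiMV X Y p).dom ∧ PhiMV X Y p x ⊆ B := by
  constructor
  · obtain ⟨q, hq⟩ := X.rep_surj x
    obtain ⟨s, hs, y, hy, -⟩ := h q q hq
    refine ⟨y, fun q r hq => ?_, q, q, hq, s, hs, hy⟩
    obtain ⟨s, hs, y, hy, -⟩ := h q r hq
    exact ⟨s, hs, Part.dom_iff_mem.2 ⟨y, hy⟩⟩
  · rintro y ⟨-, q, r, hq, s, hs, hy⟩
    obtain ⟨s', hs', y', hy', hB⟩ := h q r hq
    obtain rfl := Part.mem_unique hs hs'
    obtain rfl := Part.mem_unique hy hy'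
    exact hB

namespace MV

theorem mem_dom_comp {X Y Z : RepSpace} {f : MV Y Z} {g : MV X Y} {x : X.carrier} :
    x ∈ (f.comp g).dom ↔ x ∈ g.dom ∧ ∀ y ∈ g x, y ∈ f.dom := by
  constructor
  · rintro ⟨z, h, y, hy, -⟩
    exact ⟨⟨y, hy⟩, h⟩
  · rintro ⟨⟨y, hy⟩, h⟩
    obtain ⟨z, hz⟩ := h y hy
    exact ⟨z, h, y, hy, hz⟩

variable {U V X Y : RepSpace}

theorem mem_dom_ident_prod {f : MV U V} {c : (baireSpace.prod U).carrier} :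
    c ∈ (MV.prod (MV.ident baireSpace) f).dom ↔ c.2 ∈ f.dom := by
  constructor
  · rintro ⟨b, -, hb⟩
    exact ⟨b.2, hb⟩
  · rintro ⟨v, hv⟩
    exact ⟨(c.1, v), rfl, hv⟩

theorem mem_dom_star {f : MV U V} {g : MV X Y}
    {a : ((strongSpace Y (baireSpace.prod U)).prod X).carrier} :
    a ∈ (f.star g).dom ↔ a.2 ∈ g.dom ∧ ∀ y ∈ g a.2, y ∈ MV.dom a.1.1 ∧
      ∀ c ∈ a.1.1 y, c.2 ∈ f.dom := by
  unfold MV.star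
  rw [mem_dom_comp]
  have hdom : a ∈ (g.transpose (baireSpace.prod U)).dom ↔
      a.2 ∈ g.dom ∧ ∀ y ∈ g a.2, y ∈ MV.dom a.1.1 := mem_dom_comp
  rw [hdom]
  constructor
  · rintro ⟨⟨hx, hy⟩, h⟩
    exact ⟨hx, fun y hyg => ⟨hy y hyg, fun c hc =>
      mem_dom_ident_prod.1 (h c ⟨hy, y, hyg, hc⟩)⟩⟩
  · rintro ⟨hx, h⟩
    refine ⟨⟨hx, fun y hy => (h y hy).1⟩, ?_⟩
    rintro c ⟨-, y, hy, hc⟩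
    exact mem_dom_ident_prod.2 ((h y hy).2 c hc)

theorem mem_star {f : MV U V} {g : MV X Y}
    {a : ((strongSpace Y (baireSpace.prod U)).prod X).carrier} (ha : a ∈ (f.star g).dom)
    {b : (baireSpace.prod V).carrier} :
    b ∈ f.star g a ↔ ∃ y ∈ g a.2, ∃ c ∈ a.1.1 y, b.1 = c.1 ∧ b.2 ∈ f c.2 := by
  constructor
  · rintro ⟨-, c, ⟨-, y, hy, hc⟩, hb1, hb2⟩
    exact ⟨y, hy, c, hc, hb1, hb2⟩
  · rintro ⟨y, hy, c, hc, hb1, hb2⟩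
    have h := mem_dom_comp.1 ha
    have h' := (mem_dom_star.1 ha).2
    exact ⟨h.2, c, ⟨fun y hy => (h' y hy).1, y, hy, hc⟩, hb1, hb2⟩

theorem mem_imp {g : MV X Y} {f : MV U V} {u : U.carrier}
    {a : ((strongSpace Y V).prod X).carrier} :
    a ∈ g.imp f u ↔ a.2 ∈ g.dom ∧ ∀ y ∈ g a.2, y ∈ MV.dom a.1.1 ∧ a.1.1 y ⊆ f u := by
  constructor
  · rintro ⟨hd, hs⟩
    obtain ⟨hx, hd⟩ := mem_dom_comp.1 hd
    exact ⟨hx, fun y hy => ⟨hd y hy, fun z hz => hs ⟨hd, y, hy, hz⟩⟩⟩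
  · rintro ⟨hx, h⟩
    refine ⟨mem_dom_comp.2 ⟨hx, fun y hy => (h y hy).1⟩, ?_⟩
    rintro z ⟨-, y, hy, hz⟩
    exact (h y hy).2 hz

theorem dom_imp_subset {g : MV X Y} {f : MV U V} : (g.imp f).dom ⊆ f.dom := by
  rintro u ⟨a, ha⟩
  obtain ⟨⟨y, hy⟩, h⟩ := mem_imp.1 ha
  obtain ⟨⟨z, hz⟩, hs⟩ := h y hy
  exact ⟨z, hs hz⟩

/-- A program that ignores its input and writes a fixed name of some `v ∈ f u` solves the
implication, with any `x` in the domain of `g`. The program need not be computable. -/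
theorem dom_subset_dom_imp {g : MV X Y} (hg : g.dom.Nonempty) {f : MV U V} :
    f.dom ⊆ (g.imp f).dom := by
  rintro u ⟨v, hv⟩
  obtain ⟨x, hx⟩ := hg
  obtain ⟨c, hc⟩ := V.rep_surj v
  obtain ⟨S, -, -, hS⟩ := HasApprox.left.exists_smn
  refine ⟨(⟨PhiMV Y V (S c), S c, rfl⟩, x), mem_imp.2 ⟨hx, fun y _ => PhiMV_subset ?_⟩⟩
  intro q r _
  refine ⟨c, hS _ _ _ ?_, v, hc, hv⟩
  rw [left_bpair]
  exact Part.mem_some c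

end MV

/-! ### Weihrauch reducibility -/

namespace Problem

theorem IsRealizer.mono {F F' : Baire →. Baire} {f : Problem} (h : IsRealizer F f)
    (hF : ∀ p q, q ∈ F p → q ∈ F' p) : IsRealizer F' f := by
  cases f with
  | infty => exact h
  | fn f =>
    intro p x hx hd
    obtain ⟨q, hq, hy⟩ := h p x hx hd
    exact ⟨q, hF p q hq, hy⟩

theorem mem_wrap {K H G : Baire →. Baire} {p r : Baire} :
    r ∈ wrap K H G p ↔ ∃ a ∈ H p, ∃ b ∈ G a, r ∈ K (bpair p b) := by
  simp only [wrap, Part.mem_bind_iff]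

variable {X Y U V : RepSpace}

/-- Every multi-valued function has a realizer with a prescribed admissible value at a point. -/
theorem exists_isRealizer (f : MV X Y) (a : Baire) (v : Part Baire)
    (hv : ∀ x ∈ X.rep a, x ∈ f.dom → ∃ q ∈ v, ∃ y ∈ Y.rep q, y ∈ f x) :
    ∃ G, IsRealizer G (fn f) ∧ G a = v := by
  classical
  let P : Baire → Baire → Prop := fun p q => ∃ x ∈ X.rep p, ∃ y ∈ Y.rep q, y ∈ f x
  refine ⟨fun p => if p = a then v else if h : ∃ q, P p q then Part.some h.choose else Part.none,
    ?_, if_pos rfl⟩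
  intro p x hx hd
  by_cases hp : p = a
  · subst hp
    simpa using hv x hx hd
  · have h : ∃ q, P p q := by
      obtain ⟨y, hy⟩ := hd
      obtain ⟨q, hq⟩ := Y.rep_surj y
      exact ⟨q, x, hx, y, hq, hy⟩
    obtain ⟨x', hx', y, hy, hf⟩ := h.choose_spec
    obtain rfl := Part.mem_unique hx hx'
    refine ⟨h.choose, ?_, y, hy, hf⟩
    beta_reduce
    rw [if_neg hp, dif_pos h]
    exact Part.mem_some _

theorem exists_isRealizer_fn (f : MV X Y) : ∃ G, IsRealizer G (fn f) := by
  classical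
  let a : Baire := fun _ => 0
  by_cases h : ∃ x ∈ X.rep a, x ∈ f.dom
  · obtain ⟨x, hx, y, hy⟩ := h
    obtain ⟨q, hq⟩ := Y.rep_surj y
    obtain ⟨G, hG, -⟩ := exists_isRealizer f a (Part.some q) fun x' hx' _ => by
      obtain rfl := Part.mem_unique hx hx'
      exact ⟨q, Part.mem_some q, y, hq, hy⟩
    exact ⟨G, hG⟩
  · obtain ⟨G, hG, -⟩ := exists_isRealizer f a Part.none fun x hx hd => absurd ⟨x, hx, hd⟩ h
    exact ⟨G, hG⟩

/-- Weihrauch reducibility between multi-valued functions, expressed by names. -/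
theorem wle_fn_iff {f : MV X Y} {g : MV U V} :
    (fn f).WLE (fn g) ↔ ∃ K H : Baire →. Baire, HasApprox K ∧ HasApprox H ∧
      ∀ p x, x ∈ X.rep p → x ∈ f.dom → ∃ a ∈ H p, ∃ u ∈ U.rep a, u ∈ g.dom ∧
        ∀ q v, v ∈ V.rep q → v ∈ g u → ∃ b ∈ K (bpair p q), ∃ y ∈ Y.rep b, y ∈ f x := by
  constructor
  · rintro ⟨K, H, hK, hH, h⟩
    refine ⟨K, H, isComputable_iff.1 hK, isComputable_iff.1 hH, fun p x hx hd => ?_⟩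
    obtain ⟨G₀, hG₀⟩ := exists_isRealizer_fn g
    obtain ⟨_, hw, -⟩ := h G₀ hG₀ p x hx hd
    obtain ⟨a, ha, -⟩ := mem_wrap.1 hw
    refine ⟨a, ha, ?_⟩
    -- If `a` named no point of the domain of `g`, some realizer would be undefined at `a`, and the
    -- reduction would fail for it.
    have hu : ∃ u ∈ U.rep a, u ∈ g.dom := by
      by_contra hn
      obtain ⟨G, hG, hGa⟩ := exists_isRealizer g a Part.none fun u hu hd => absurd ⟨u, hu, hd⟩ hn
      obtain ⟨_, hw, -⟩ := h G hG p x hx hd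
      obtain ⟨a', ha', b, hb, -⟩ := mem_wrap.1 hw
      obtain rfl := Part.mem_unique ha ha'
      rw [hGa] at hb
      exact Part.notMem_none _ hb
    obtain ⟨u, hu, hud⟩ := hu
    refine ⟨u, hu, hud, fun q v hq hv => ?_⟩
    -- Any name `q` of an admissible value is the reply of some realizer, so `K` has to cope with
    -- every such `q`.
    obtain ⟨G, hG, hGa⟩ := exists_isRealizer g a (Part.some q) fun u' hu' _ => by
      obtain rfl := Part.mem_unique hu hu'
      exact ⟨q, Part.mem_some q, v, hq, hv⟩
    obtain ⟨b, hw, hy⟩ := h G hG p x hx hd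
    obtain ⟨a', ha', q', hq', hb⟩ := mem_wrap.1 hw
    obtain rfl := Part.mem_unique ha ha'
    rw [hGa] at hq'
    obtain rfl := Part.mem_some_iff.1 hq'
    exact ⟨b, hb, hy⟩
  · rintro ⟨K, H, hK, hH, h⟩
    refine ⟨K, H, isComputable_iff.2 hK, isComputable_iff.2 hH, fun G hG p x hx hd => ?_⟩
    obtain ⟨a, ha, u, hu, hud, h⟩ := h p x hx hd
    obtain ⟨q, hq, v, hv, hvg⟩ := hG a u hu hud
    obtain ⟨b, hb, hy⟩ := h q v hv hvg
    exact ⟨b, mem_wrap.2 ⟨a, ha, q, hq, hb⟩, hy⟩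

theorem wle_infty (f : Problem) : f.WLE infty :=
  ⟨_, _, isComputable_iff.2 HasApprox.ident, isComputable_iff.2 HasApprox.ident,
    fun _ hG => hG.elim⟩

theorem wle_of_dom_eq_empty {f : MV X Y} (hf : f.dom = ∅) (g : Problem) : (fn f).WLE g :=
  ⟨_, _, isComputable_iff.2 HasApprox.ident, isComputable_iff.2 HasApprox.ident,
    fun _ _ _ x _ hx => absurd hx (by simp [hf])⟩

theorem zero_wle (g : Problem) : zero.WLE g :=
  wle_of_dom_eq_empty (Set.eq_empty_iff_forall_notMem.2 fun _ h => h.elim fun _ h => h) g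

/-- Every multi-valued function has a realizer, by choice; a reduction would turn it into a realizer
of `∞`. -/
theorem not_infty_wle_fn (f : MV X Y) : ¬ infty.WLE (fn f) := by
  rintro ⟨K, H, -, -, h⟩
  obtain ⟨G, hG⟩ := exists_isRealizer_fn f
  exact h G hG

theorem dom_eq_empty_of_wle {f : MV X Y} {g : MV U V} (h : (fn f).WLE (fn g)) (hg : g.dom = ∅) :
    f.dom = ∅ := by
  obtain ⟨K, H, -, -, h⟩ := wle_fn_iff.1 h
  refine Set.eq_empty_iff_forall_notMem.2 fun x hx => ?_
  obtain ⟨p, hp⟩ := X.rep_surj x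
  obtain ⟨a, -, u, -, hu, -⟩ := h p x hp hx
  simp [hg] at hu

theorem WLE.refl (f : Problem) : f.WLE f := by
  refine ⟨_, _, isComputable_iff.2 HasApprox.right, isComputable_iff.2 HasApprox.ident,
    fun G hG => hG.mono fun p q hq => mem_wrap.2 ⟨p, Part.mem_some p, q, hq, ?_⟩⟩
  rw [right_bpair]
  exact Part.mem_some q

theorem WLE.trans {f g h : Problem} (hfg : f.WLE g) (hgh : g.WLE h) : f.WLE h := by
  obtain ⟨K, H, hK, hH, h₁⟩ := hfg
  obtain ⟨K', H', hK', hH', h₂⟩ := hgh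
  rw [isComputable_iff] at hK hH hK' hH'
  -- The inner `K'` needs the intermediate query `a`, which is recomputed from the original input.
  let K'' : Baire →. Baire := fun o => (H (left o)).bind fun a =>
    (K' (bpair a (right o))).bind fun b => K (bpair (left o) b)
  have hK'' : HasApprox K'' := by
    refine (hH.comp_total HasApprox.left).bind (G := fun o a =>
      (K' (bpair a (right o))).bind fun b => K (bpair (left o) b)) ?_
    refine HasApprox.bind (hK'.comp_total
      (HasApprox.right.pair_total (HasApprox.right.comp_total HasApprox.left)))
      (G := fun o b => K (bpair (left (left o)) b)) ?_
    exact hK.comp_total ((HasApprox.left.comp_total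
      (HasApprox.left.comp_total HasApprox.left)).pair_total HasApprox.right)
  refine ⟨K'', fun p => (H p).bind H', isComputable_iff.2 hK'', isComputable_iff.2 (hH'.comp hH),
    fun G hG => (h₁ _ (h₂ G hG)).mono fun p r hr => ?_⟩
  obtain ⟨a, ha, b, hb, hr⟩ := mem_wrap.1 hr
  obtain ⟨a', ha', b', hb', hb⟩ := mem_wrap.1 hb
  refine mem_wrap.2 ⟨a', Part.mem_bind ha ha', b', hb', ?_⟩
  simp only [K'', left_bpair, right_bpair]
  exact Part.mem_bind ha (Part.mem_bind hb hr)

/-! ### The compositional product and the implication -/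

theorem star_infty (f : Problem) : f.star infty = infty := by cases f <;> rfl

theorem infty_star (f : Problem) : infty.star f = infty := by cases f <;> rfl

theorem fn_star_mono {U V X Y U' V' X' Y' : RepSpace} {f : MV U V} {f' : MV U' V'} {g : MV X Y}
    {g' : MV X' Y'} (hf : (fn f).WLE (fn f')) (hg : (fn g).WLE (fn g')) :
    (fn (f.star g)).WLE (fn (f'.star g')) := by
  obtain ⟨K₁, H₁, hK₁, hH₁, h₁⟩ := wle_fn_iff.1 hf
  obtain ⟨K₂, H₂, hK₂, hH₂, h₂⟩ := wle_fn_iff.1 hg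
  let z : Baire := fun _ => 0
  -- On `⟨⟨T, x⟩, ⟨y', r⟩⟩` this translates the answer `y'` of `g'` back to `g`, runs `T` on it with
  -- output `s`, and translates the `U`-part of `s` into a query to `f'`. All of `s` goes into the
  -- `ℕ^ℕ` component: `K₁` later needs its right half, the final answer its left half.
  let F : Baire →. Baire := fun o =>
    (K₂ (bpair (right (left o)) (left (right o)))).bind fun y =>
      (Phi (left (left o)) (bpair y z)).bind fun s => (H₁ (right s)).map (bpair s)
  have hF : HasApprox F := by
    have hl := HasApprox.left
    have hr := HasApprox.right
    refine (hK₂.comp_total ((hr.comp_total hl).pair_total (hl.comp_total hr))).bind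
      (G := fun o y => (Phi (left (left o)) (bpair y z)).bind fun s => (H₁ (right s)).map (bpair s))
      ?_
    refine HasApprox.comp (G := fun s => (H₁ (right s)).map (bpair s)) ?_
      ((hl.comp_total (hl.comp_total hl)).Phi (hr.pair_total HasApprox.zero))
    exact (HasApprox.ident.pair (hH₁.comp_total hr)).mono fun o r h =>
      Part.mem_bind (Part.mem_some o) h
  obtain ⟨S, hS, -, hSF⟩ := hF.exists_smn
  refine wle_fn_iff.2 ⟨fun o => (K₁ (bpair (right (left (right o))) (right (right o)))).map
      (bpair (left (left (right o)))), fun p => (H₂ (right p)).map (bpair (S p)), ?_, ?_, ?_⟩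
  · have hl := HasApprox.left
    have hr := HasApprox.right
    have hlr := hl.comp_total hr
    exact ((hl.comp_total hlr).pair (hK₁.comp_total ((hr.comp_total hlr).pair_total
      (hr.comp_total hr)))).mono fun o r h => Part.mem_bind (Part.mem_some _) h
  · exact (hS.pair (hH₂.comp_total HasApprox.right)).mono fun o r h =>
      Part.mem_bind (Part.mem_some _) h
  rintro p ⟨T, x⟩ hp hd
  obtain ⟨hT, hx⟩ := mem_prod_rep.1 hp
  obtain ⟨hxd, hy⟩ := MV.mem_dom_star.1 hd
  dsimp only at hT hx hxd hy
  rw [mem_strongSpace_rep] at hT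
  obtain ⟨a, ha, x', hx', hxd', hK⟩ := h₂ (right p) x hx hxd
  -- the values of the transformed query at all names of points of `g' x'`
  have key : ∀ y' ∈ g' x', ∀ q r, y' ∈ Y'.rep q → ∃ s' ∈ Phi (S p) (bpair q r),
      ∃ c' ∈ (baireSpace.prod U').rep s', c' ∈ {c' : (baireSpace.prod U').carrier |
        c'.2 ∈ f'.dom ∧ ∃ y ∈ g x, ∃ c ∈ T.1 y, c.1 = left c'.1 ∧
          ∀ q v, v ∈ V'.rep q → v ∈ f' c'.2 →
            ∃ b ∈ K₁ (bpair (right c'.1) q), ∃ w ∈ V.rep b, w ∈ f c.2} := by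
    intro y' hy' q r hq
    obtain ⟨b, hb, y, hyb, hyg⟩ := hK q y' hq hy'
    obtain ⟨hyd, hc⟩ := hy y hyg
    rw [hT] at hyd
    obtain ⟨s, hs, c, hcs, hcT⟩ := exists_mem_PhiMV hyd hyb z
    rw [← hT] at hcT
    obtain ⟨hc1, hc2⟩ := mem_prod_rep.1 hcs
    replace hc1 := mem_baireSpace_rep.1 hc1
    obtain ⟨a', ha', u', hu', hud', hK'⟩ := h₁ (right s) c.2 hc2 (hc c hcT)
    refine ⟨bpair s a', hSF _ _ _ ?_, (s, u'), mem_prod_rep_bpair.2 ⟨Part.mem_some s, hu'⟩,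
      hud', y, hyg, c, hcT, hc1, hK'⟩
    simp only [F, left_bpair, right_bpair]
    exact Part.mem_bind hb (Part.mem_bind hs (Part.mem_map _ ha'))
  let T' : (strongSpace Y' (baireSpace.prod U')).carrier := ⟨PhiMV _ _ (S p), S p, rfl⟩
  have hd' : (T', x') ∈ (f'.star g').dom := MV.mem_dom_star.2 ⟨hxd', fun y' hy' =>
    ⟨(PhiMV_subset (key y' hy')).1, fun c hc => ((PhiMV_subset (key y' hy')).2 hc).1⟩⟩
  refine ⟨bpair (S p) a, Part.mem_map _ ha, (T', x'),
    mem_prod_rep_bpair.2 ⟨Part.mem_some _, hx'⟩, hd', ?_⟩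
  rintro q ⟨s, v'⟩ hq hv
  obtain ⟨hs, hv'⟩ := mem_prod_rep.1 hq
  obtain rfl := mem_baireSpace_rep.1 hs
  obtain ⟨y', hy', c', hc', hsc, hvc⟩ := (MV.mem_star hd').1 hv
  dsimp only at hsc hvc hy' hc' hv'
  obtain ⟨-, y, hyg, c, hc, hc1, hK'⟩ := (PhiMV_subset (key y' hy')).2 hc'
  rw [← hsc] at hc1 hK'
  obtain ⟨b, hb, w, hw, hwf⟩ := hK' (right q) v' hv' hvc
  refine ⟨bpair (left (left q)) b, ?_, (left (left q), w),
    mem_prod_rep_bpair.2 ⟨Part.mem_some _, hw⟩, (MV.mem_star hd).2 ⟨y, hyg, c, hc, hc1.symm, hwf⟩⟩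
  simp only [right_bpair]
  exact Part.mem_map _ hb

theorem star_mono {f f' g g' : Problem} (hf : f.WLE f') (hg : g.WLE g') :
    (f.star g).WLE (f'.star g') := by
  cases f' with
  | infty => rw [infty_star]; exact wle_infty _
  | fn f' =>
  cases g' with
  | infty => rw [star_infty]; exact wle_infty _
  | fn g' =>
  cases f with
  | infty => exact absurd hf (not_infty_wle_fn f')
  | fn f =>
  cases g with
  | infty => exact absurd hg (not_infty_wle_fn g')
  | fn g => exact fn_star_mono hf hg

/-- The middle program `t` merely drops the cylinder part: a name of `(H, x)` is reread as a name of
(program of `H`, `x`). The outer functional then runs that program on the answer of `g`; `z` is a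
dummy cylinder component. -/
theorem fn_wle_star_imp {U V X Y : RepSpace} (f : MV U V) {g : MV X Y} (hg : g.dom.Nonempty) :
    (fn f).WLE (fn (g.star (g.imp f))) := by
  obtain ⟨t, htc, ht⟩ := isComputable_iff.2 HasApprox.left
  let z : Baire := fun _ => 0
  refine wle_fn_iff.2 ⟨fun o => Phi (left (right o)) (bpair (right (right o)) z),
    fun u => Part.some (bpair t u), ?_, (HasApprox.const htc).pair_total HasApprox.ident, ?_⟩
  · exact (HasApprox.left.comp_total HasApprox.right).Phi
      ((HasApprox.right.comp_total HasApprox.right).pair_total HasApprox.zero)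
  intro p u hp hu
  let T : (strongSpace ((strongSpace Y V).prod X) (baireSpace.prod X)).carrier :=
    ⟨PhiMV _ _ t, t, rfl⟩
  have key : ∀ a : ((strongSpace Y V).prod X).carrier, a ∈ MV.dom T.1 ∧
      T.1 a ⊆ {c | a.1.1 = PhiMV Y V c.1 ∧ c.2 = a.2} := by
    intro a
    refine PhiMV_subset fun q r hq => ⟨q, ht _ _ ?_, (left q, a.2), ?_, ?_, rfl⟩
    · beta_reduce
      rw [left_bpair]
      exact Part.mem_some q
    · exact mem_prod_rep.2 ⟨Part.mem_some _, (mem_prod_rep.1 hq).2⟩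
    · exact mem_strongSpace_rep.1 (mem_prod_rep.1 hq).1
  have hd : (T, u) ∈ (g.star (g.imp f)).dom := by
    refine MV.mem_dom_star.2 ⟨MV.dom_subset_dom_imp hg hu, fun a ha => ⟨(key a).1, fun c hc => ?_⟩⟩
    rw [((key a).2 hc).2]
    exact (MV.mem_imp.1 ha).1
  refine ⟨_, Part.mem_some _, (T, u), mem_prod_rep_bpair.2 ⟨Part.mem_some _, hp⟩, hd, ?_⟩
  rintro q ⟨s, y⟩ hq hy
  obtain ⟨hs, hyq⟩ := mem_prod_rep.1 hq
  obtain rfl := mem_baireSpace_rep.1 hs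
  obtain ⟨a, ha, c, hc, hsc, hyc⟩ := (MV.mem_star hd).1 hy
  obtain ⟨hac, hca⟩ := (key a).2 hc
  dsimp only at hsc hyc hyq
  rw [← hsc] at hac
  rw [hca] at hyc
  obtain ⟨hyd, hys⟩ := (MV.mem_imp.1 ha).2 y hyc
  rw [hac] at hyd hys
  obtain ⟨b, hb, v, hv, hvf⟩ := exists_mem_PhiMV hyd hyq z
  refine ⟨b, ?_, v, hv, hys hvf⟩
  beta_reduce
  rwa [right_bpair]

theorem wle_star_imp (f g : Problem) : f.WLE (g.star (g.imp f)) := by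
  cases g with
  | infty => rw [infty_star]; exact wle_infty f
  | fn g =>
  cases f with
  | infty => exact wle_infty _
  | fn f =>
    by_cases h : g.dom.Nonempty
    · rw [imp, if_pos (Or.inl h)]
      exact fn_wle_star_imp f h
    · by_cases hf : f.dom = ∅
      · exact wle_of_dom_eq_empty hf _
      · rw [imp, if_neg (by tauto), star_infty]
        exact wle_infty _

theorem fn_imp_wle_of_wle_star {U V X Y W Z : RepSpace} {f : MV U V} {g : MV X Y} {h : MV W Z}
    (hf : (fn f).WLE (fn (g.star h))) : (fn (g.imp f)).WLE (fn h) := by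
  obtain ⟨K, H, hK, hH, hKH⟩ := wle_fn_iff.1 hf
  let z : Baire := fun _ => 0
  -- the functional `⟨⟨u, a⟩, ⟨v, r⟩⟩ ↦ K ⟨u, ⟨a, v⟩⟩`
  have hl := HasApprox.left
  have hr := HasApprox.right
  have hF := hK.comp_total ((hl.comp_total hl).pair_total
    ((hr.comp_total hl).pair_total (hl.comp_total hr)))
  obtain ⟨S, hS, -, hSF⟩ := hF.exists_smn
  refine wle_fn_iff.2 ⟨fun o => (H (left o)).bind fun a => (Phi (left a) (bpair (right o) z)).bind
    fun s => Part.some (bpair (S (bpair (left o) (left s))) (right s)),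
    fun u => (H u).bind fun a => Part.some (right a), ?_, hr.comp hH, ?_⟩
  · refine (hH.comp_total hl).bind (G := fun o a => (Phi (left a) (bpair (right o) z)).bind
      fun s => Part.some (bpair (S (bpair (left o) (left s))) (right s))) ?_
    refine ((hl.comp_total hr).Phi ((hr.comp_total hl).pair_total HasApprox.zero)).bind
      (G := fun o s => Part.some (bpair (S (bpair (left (left o)) (left s))) (right s))) ?_
    exact (hS.comp_total ((hl.comp_total (hl.comp_total hl)).pair_total
      (hl.comp_total hr))).pair_total (hr.comp_total hr)
  intro p u hp hu
  obtain ⟨a, ha, ⟨T, x⟩, hTx, hd, hq⟩ := hKH p u hp (MV.dom_imp_subset hu)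
  obtain ⟨hT, hx⟩ := mem_prod_rep.1 hTx
  obtain ⟨hxd, hy⟩ := MV.mem_dom_star.1 hd
  dsimp only at hT hx hxd hy
  rw [mem_strongSpace_rep] at hT
  refine ⟨right a, Part.mem_bind ha (Part.mem_some _), x, hx, hxd, fun q y hyq hyh => ?_⟩
  obtain ⟨hyd, hc⟩ := hy y hyh
  rw [hT] at hyd
  obtain ⟨s, hs, c, hcs, hcT⟩ := exists_mem_PhiMV hyd hyq z
  rw [← hT] at hcT
  obtain ⟨hc1, hc2⟩ := mem_prod_rep.1 hcs
  replace hc1 := mem_baireSpace_rep.1 hc1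
  -- `e` is a program for `v ↦ K ⟨p, ⟨left s, v⟩⟩`: everything but the answer `v` of `g` is frozen.
  let e := S (bpair p (left s))
  refine ⟨bpair e (right s), ?_, (⟨PhiMV Y V e, e, rfl⟩, c.2),
    mem_prod_rep_bpair.2 ⟨Part.mem_some _, hc2⟩, MV.mem_imp.2 ⟨hc c hcT, fun w hw => ?_⟩⟩
  · simp only [left_bpair, right_bpair]
    exact Part.mem_bind ha (Part.mem_bind hs (Part.mem_some _))
  refine PhiMV_subset fun v r hv => ?_
  obtain ⟨b, hb, hbf⟩ := hq (bpair (left s) v) (left s, w)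
    (mem_prod_rep_bpair.2 ⟨Part.mem_some _, hv⟩)
    ((MV.mem_star hd).2 ⟨y, hyh, c, hcT, hc1.symm, hw⟩)
  refine ⟨b, hSF _ _ _ ?_, hbf⟩
  simpa only [left_bpair, right_bpair] using hb

theorem imp_wle_of_wle_star {f g h : Problem} (hf : f.WLE (g.star h)) : (g.imp f).WLE h := by
  cases g with
  | infty => exact zero_wle h
  | fn g =>
  cases h with
  | infty => exact wle_infty _
  | fn h =>
  cases f with
  | infty => exact absurd hf (not_infty_wle_fn _)
  | fn f =>
    -- A point in the domain of `g ⋆ h` yields one in the domain of `g`, so a nowhere defined `g`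
    -- forces `f` to be nowhere defined. This excludes the branch in which the implication is `∞`.
    have hgf : g.dom.Nonempty ∨ f.dom = ∅ := by
      refine or_iff_not_imp_left.2 fun hg => dom_eq_empty_of_wle hf ?_
      refine Set.eq_empty_iff_forall_notMem.2 fun a ha => hg ?_
      obtain ⟨⟨y, hy⟩, h⟩ := MV.mem_dom_star.1 ha
      obtain ⟨⟨c, hc⟩, h⟩ := h y hy
      exact ⟨_, h c hc⟩
    rw [imp, if_pos hgf]
    exact fn_imp_wle_of_wle_star hf

theorem wle_star_iff (f g h : Problem) : f.WLE (g.star h) ↔ (g.imp f).WLE h :=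
  ⟨imp_wle_of_wle_star, fun H => (wle_star_imp f g).trans (star_mono (WLE.refl g) H)⟩

/-- Purely formal: `f ≤ f' ≤ g' ⋆ (g' → f') ≤ g ⋆ (g' → f')`, and minimality of `(g → f)` concludes.
-/
theorem imp_mono {f f' g g' : Problem} (hg : g'.WLE g) (hf : f.WLE f') :
    (g.imp f).WLE (g'.imp f') :=
  imp_wle_of_wle_star ((hf.trans (wle_star_imp f' g')).trans (star_mono hg (WLE.refl _)))

theorem WEquiv.star {f f' g g' : Problem} (hf : f.WEquiv f') (hg : g.WEquiv g') :
    (f.star g).WEquiv (f'.star g') :=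
  ⟨star_mono hf.1 hg.1, star_mono hf.2 hg.2⟩

theorem WEquiv.imp {f f' g g' : Problem} (hf : f.WEquiv f') (hg : g.WEquiv g') :
    (f.imp g).WEquiv (f'.imp g') :=
  ⟨imp_mono hf.2 hg.1, imp_mono hf.1 hg.2⟩

theorem WEquiv.refl (f : Problem) : f.WEquiv f := ⟨WLE.refl f, WLE.refl f⟩

theorem equivalence_wequiv : Equivalence WEquiv :=
  ⟨WEquiv.refl, fun h => ⟨h.2, h.1⟩, fun h h' => ⟨h.1.trans h'.1, h'.2.trans h.2⟩⟩

end Problem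

/-! ### Weihrauch degrees -/

namespace Degree

theorem of_eq_of_iff {f g : Problem} : of f = of g ↔ f.WEquiv g :=
  Problem.equivalence_wequiv.quot_mk_eq_iff f g

theorem of_le_of_iff {f g : Problem} : of f ≤ of g ↔ f.WLE g := by
  constructor
  · rintro ⟨f', g', hf, hg, h⟩
    exact ((of_eq_of_iff.1 hf).2.trans h).trans (of_eq_of_iff.1 hg).1
  · exact fun h => ⟨f, g, rfl, rfl, h⟩

theorem exists_of (a : Degree) : ∃ f, of f = a := Quot.exists_rep a

theorem isPartialOrder_le : IsPartialOrder Degree (fun a b => a ≤ b) where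
  refl a := by
    obtain ⟨f, rfl⟩ := exists_of a
    exact of_le_of_iff.2 (Problem.WLE.refl f)
  trans a b c hab hbc := by
    obtain ⟨f, rfl⟩ := exists_of a
    obtain ⟨g, rfl⟩ := exists_of b
    obtain ⟨h, rfl⟩ := exists_of c
    exact of_le_of_iff.2 ((of_le_of_iff.1 hab).trans (of_le_of_iff.1 hbc))
  antisymm a b hab hba := by
    obtain ⟨f, rfl⟩ := exists_of a
    obtain ⟨g, rfl⟩ := exists_of b
    exact of_eq_of_iff.2 ⟨of_le_of_iff.1 hab, of_le_of_iff.1 hba⟩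

/-- The compositional product of degrees. -/
def star : Degree → Degree → Degree :=
  Quot.map₂ Problem.star (fun f _ _ h => (Problem.WEquiv.refl f).star h)
    (fun _ _ g h => h.star (Problem.WEquiv.refl g))

/-- The implication of degrees. -/
noncomputable def imp : Degree → Degree → Degree :=
  Quot.map₂ Problem.imp (fun f _ _ h => (Problem.WEquiv.refl f).imp h)
    (fun _ _ g h => h.imp (Problem.WEquiv.refl g))

theorem le_star_iff (a b c : Degree) : a ≤ star b c ↔ imp b a ≤ c := by
  obtain ⟨f, rfl⟩ := exists_of a
  obtain ⟨g, rfl⟩ := exists_of b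
  obtain ⟨h, rfl⟩ := exists_of c
  exact of_le_of_iff.trans ((Problem.wle_star_iff f g h).trans of_le_of_iff.symm)

theorem isLeast_imp (a b : Degree) : IsLeast {c | a ≤ star b c} (imp b a) :=
  ⟨(le_star_iff a b _).2 (isPartialOrder_le.refl _), fun c hc => (le_star_iff a b c).1 hc⟩

end Degree

end Weihrauch

theorem theorem24 :
    -- `(g → f)` is the least `h` with `f ≤_W g ⋆ h`
    (∀ f g : Weihrauch.Problem,
      f.WLE (g.star (g.imp f)) ∧
        ∀ h : Weihrauch.Problem, f.WLE (g.star h) → (g.imp f).WLE h) ∧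
    -- the residuation equivalence
    (∀ f g h : Weihrauch.Problem, f.WLE (g.star h) ↔ (g.imp f).WLE h) ∧
    -- both operations respect Weihrauch equivalence
    (∀ f f' g g' : Weihrauch.Problem, f.WEquiv f' → g.WEquiv g' →
      (f.star g).WEquiv (f'.star g') ∧ (f.imp g).WEquiv (f'.imp g')) ∧
    -- the degrees are partially ordered by the order induced by `≤_W`
    IsPartialOrder Weihrauch.Degree (fun a b => a ≤ b) ∧
    (∀ f g : Weihrauch.Problem,
      Weihrauch.Degree.of f ≤ Weihrauch.Degree.of g ↔ f.WLE g) ∧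
    -- the induced operations on degrees, and right residuation with respect to `≥_W`
    ∃ star imp : Weihrauch.Degree → Weihrauch.Degree → Weihrauch.Degree,
      (∀ f g : Weihrauch.Problem,
        star (Weihrauch.Degree.of f) (Weihrauch.Degree.of g) = Weihrauch.Degree.of (f.star g)) ∧
      (∀ f g : Weihrauch.Problem,
        imp (Weihrauch.Degree.of g) (Weihrauch.Degree.of f) = Weihrauch.Degree.of (g.imp f)) ∧
      (∀ a b : Weihrauch.Degree, IsLeast {c | a ≤ star b c} (imp b a)) ∧
      (∀ a b c : Weihrauch.Degree, a ≤ star b c ↔ imp b a ≤ c) ∧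
      Weihrauch.RightResiduated (fun a b : Weihrauch.Degree => b ≤ a) star := by
  refine ⟨fun f g => ⟨Weihrauch.Problem.wle_star_imp f g, fun h =>
      Weihrauch.Problem.imp_wle_of_wle_star⟩, Weihrauch.Problem.wle_star_iff,
    fun f f' g g' hf hg => ⟨hf.star hg, hf.imp hg⟩, Weihrauch.Degree.isPartialOrder_le,
    fun f g => Weihrauch.Degree.of_le_of_iff, Weihrauch.Degree.star, Weihrauch.Degree.imp,
    fun f g => rfl, fun f g => rfl, Weihrauch.Degree.isLeast_imp, Weihrauch.Degree.le_star_iff,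
    fun b a => ⟨Weihrauch.Degree.imp b a, (Weihrauch.Degree.isLeast_imp a b).1,
      fun c hc => (Weihrauch.Degree.isLeast_imp a b).2 hc⟩⟩
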